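/- For $r\ge 1$ let $M_r$ be the complex $r\times r$ matrices and identify $M_r\otimes M_s\simeq M_{rs}$ via the Kronecker product. A matrix $A=\sum_i A_i\otimes B_i\in M_r\otimes M_s$ is PPT if $A$ and its partial transposition $A^{t_2}=\sum_i A_i\otimes B_i^t$ are both positive semidefinite Hermitian; put $G_A:M_r\to M_s$, $G_A(X)=\sum_i \mathrm{tr}(A_iX)B_i$, and $G_A((\cdot)^t):X\mapsto G_A(X^t)$. A positive map is a linear map $T:M_r\to M_s$ sending positive semidefinite Hermitian matrices to positive semidefinite Hermitian matrices; it is doubly stochastic if $T(\frac{Id}{\sqrt r})=\frac{Id}{\sqrt s}$ and $T^*(\frac{Id}{\sqrt s})=\frac{Id}{\sqrt r}$, where $T^*$ is the adjoint with respect to the trace inner product $\langle A,B\rangle=\mathrm{tr}(AB^*)$. Positive maps $L_1,L_2:M_r\to M_s$ are equivalent if there are invertible $R\in M_r$, $S\in M_s$ with $L_2(X)=S\,L_1(RXR^*)\,S^*$ for all $X\in M_r$. Let $k,m\ge 1$, let $B=\sum_{i=1}^n C_i\otimes D_i\in M_k\otimes M_m$ be PPT, and define $$\widetilde B=\sum_{i=1}^n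 (Id_m\otimes C_i)\otimes(D_i\otimes Id_k)\in M_{mk}\otimes M_{mk},$$ where $M_m\otimes M_k\simeq M_{mk}$. Then $\widetilde B$ is PPT, and $G_B((\cdot)^t):M_k\to M_m$ is equivalent to a doubly stochastic map if and only if $G_{\widetilde B}((\cdot)^t):M_{mk}\to M_{mk}$ is equivalent to a doubly stochastic map. -/

import Mathlib

open scoped ComplexOrder TensorProduct Kronecker Matrix

namespace SinkhornKnoppPPT

noncomputable section

/-- The Kronecker-product identification of `M_ι ⊗ M_κ` with the matrices indexed by `ι × κ`. -/
def toKron (ι κ : Type*) :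
    Matrix ι ι ℂ ⊗[ℂ] Matrix κ κ ℂ →ₗ[ℂ] Matrix (ι × κ) (ι × κ) ℂ :=
  TensorProduct.lift (Matrix.kroneckerMapBilinear (Algebra.lmul ℂ ℂ).toLinearMap)

@[simp] theorem toKron_tmul {ι κ : Type*} (A : Matrix ι ι ℂ) (B : Matrix κ κ ℂ) :
    toKron ι κ (A ⊗ₜ[ℂ] B) = A ⊗ₖ B := rfl

/-- Partial transposition in the second factor: `A ⊗ B ↦ A ⊗ Bᵗ`. -/
def partialTranspose (ι κ : Type*) :
    Matrix ι ι ℂ ⊗[ℂ] Matrix κ κ ℂ →ₗ[ℂ] Matrix ι ι ℂ ⊗[ℂ] Matrix κ κ ℂ :=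
  TensorProduct.map LinearMap.id (Matrix.transposeLinearEquiv κ κ ℂ ℂ).toLinearMap

@[simp] theorem partialTranspose_tmul {ι κ : Type*} (A : Matrix ι ι ℂ) (B : Matrix κ κ ℂ) :
    partialTranspose ι κ (A ⊗ₜ[ℂ] B) = A ⊗ₜ[ℂ] Bᵀ := rfl

/-- `A` and its partial transposition are positive semidefinite Hermitian matrices. -/
def IsPPT {ι κ : Type*} (A : Matrix ι ι ℂ ⊗[ℂ] Matrix κ κ ℂ) : Prop :=
  (toKron ι κ A).PosSemidef ∧ (toKron ι κ (partialTranspose ι κ A)).PosSemidef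

/-- `G_A(X) = ∑ tr(A_i X) B_i` for `A = ∑ A_i ⊗ B_i`, as a linear function of `A`. -/
def G {ι κ : Type*} [Fintype ι] :
    Matrix ι ι ℂ ⊗[ℂ] Matrix κ κ ℂ →ₗ[ℂ] (Matrix ι ι ℂ →ₗ[ℂ] Matrix κ κ ℂ) :=
  TensorProduct.lift <| LinearMap.mk₂ ℂ
    (fun A B => ((Matrix.traceLinearMap ι ℂ ℂ).comp (LinearMap.mulLeft ℂ A)).smulRight B)
    (fun A A' B => by ext1 X; simp [add_mul, add_smul])
    (fun c A B => by ext1 X; simp [mul_smul])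
    (fun A B B' => by ext1 X; simp)
    (fun c A B => by ext1 X; simp [smul_smul, mul_comm])

theorem G_sum_tmul {ι κ α : Type*} [Fintype ι] (s : Finset α)
    (A : α → Matrix ι ι ℂ) (B : α → Matrix κ κ ℂ) (X : Matrix ι ι ℂ) :
    G (∑ i ∈ s, A i ⊗ₜ[ℂ] B i) X = ∑ i ∈ s, (A i * X).trace • B i := by
  simp [G]

/-- The map `G_A((·)ᵗ) : X ↦ G_A(Xᵗ)`. -/
def Gt {ι κ : Type*} [Fintype ι] (A : Matrix ι ι ℂ ⊗[ℂ] Matrix κ κ ℂ) :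
    Matrix ι ι ℂ →ₗ[ℂ] Matrix κ κ ℂ :=
  (G A).comp (Matrix.transposeLinearEquiv ι ι ℂ ℂ).toLinearMap

theorem Gt_apply {ι κ : Type*} [Fintype ι] (A : Matrix ι ι ℂ ⊗[ℂ] Matrix κ κ ℂ)
    (X : Matrix ι ι ℂ) : Gt A X = G A Xᵀ := rfl

/-- Positive maps: linear maps sending positive semidefinite matrices to such matrices. -/
def IsPositiveMap {ι κ : Type*} (T : Matrix ι ι ℂ →ₗ[ℂ] Matrix κ κ ℂ) : Prop :=
  ∀ X : Matrix ι ι ℂ, X.PosSemidef → (T X).PosSemidef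

/-- The adjoint `T*` of `T` for the trace inner product `⟨A, B⟩ = tr(A B*)`, given by its entries
`(T* Y)_{ij} = ⟨Y, T(E_{ij})⟩`. See `trace_traceAdjoint`, `eq_traceAdjoint`. -/
def traceAdjoint {ι κ : Type*} [DecidableEq ι] [Fintype κ]
    (T : Matrix ι ι ℂ →ₗ[ℂ] Matrix κ κ ℂ) : Matrix κ κ ℂ →ₗ[ℂ] Matrix ι ι ℂ where
  toFun Y := Matrix.of fun i j => (Y * (T (Matrix.single i j 1))ᴴ).trace
  map_add' Y Z := by ext i j; simp [add_mul]
  map_smul' c Y := by ext i j; simp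

theorem trace_traceAdjoint {ι κ : Type*} [Fintype ι] [DecidableEq ι] [Fintype κ]
    (T : Matrix ι ι ℂ →ₗ[ℂ] Matrix κ κ ℂ) (X : Matrix ι ι ℂ) (Y : Matrix κ κ ℂ) :
    (T X * Yᴴ).trace = (X * (traceAdjoint T Y)ᴴ).trace := by
  have h : ∀ i j, star ((Y * (T (Matrix.single i j 1))ᴴ).trace)
      = (T (Matrix.single i j 1) * Yᴴ).trace := fun i j => by
    rw [← Matrix.trace_conjTranspose]; simp
  conv_lhs => rw [Matrix.matrix_eq_sum_single X]
  have h1 : ∀ i j, Matrix.single i j (X i j) = X i j • Matrix.single i j (1 : ℂ) := by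
    intro i j; simp
  simp only [h1, map_sum, map_smul, Finset.sum_mul, Matrix.smul_mul, Matrix.trace_sum,
    Matrix.trace_smul, smul_eq_mul]
  simp only [Matrix.trace, Matrix.diag_apply, Matrix.mul_apply (M := X),
    Matrix.conjTranspose_apply (M := traceAdjoint T Y)]
  refine Finset.sum_congr rfl fun i _ => Finset.sum_congr rfl fun j _ => ?_
  congr 1
  exact (h i j).symm

theorem eq_traceAdjoint {ι κ : Type*} [Fintype ι] [DecidableEq ι] [Fintype κ]
    (T : Matrix ι ι ℂ →ₗ[ℂ] Matrix κ κ ℂ) (S : Matrix κ κ ℂ →ₗ[ℂ] Matrix ι ι ℂ)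
    (hS : ∀ X Y, (T X * Yᴴ).trace = (X * (S Y)ᴴ).trace) : S = traceAdjoint T := by
  ext1 Y
  apply Matrix.conjTranspose_injective
  rw [Matrix.ext_iff_trace_mul_left]
  intro X
  rw [← hS, trace_traceAdjoint]

/-- Doubly stochastic maps: positive maps with `T(Id/√k) = Id/√m` and `T*(Id/√m) = Id/√k`,
where `k` and `m` are the orders of the matrices in the domain and in the codomain. -/
def IsDoublyStochastic {ι κ : Type*} [Fintype ι] [DecidableEq ι] [Fintype κ] [DecidableEq κ]
    (T : Matrix ι ι ℂ →ₗ[ℂ] Matrix κ κ ℂ) : Prop :=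
  IsPositiveMap T ∧
  T (((√(Fintype.card ι : ℝ) : ℝ) : ℂ)⁻¹ • 1) = ((√(Fintype.card κ : ℝ) : ℝ) : ℂ)⁻¹ • 1 ∧
  traceAdjoint T (((√(Fintype.card κ : ℝ) : ℝ) : ℂ)⁻¹ • 1)
    = ((√(Fintype.card ι : ℝ) : ℝ) : ℂ)⁻¹ • 1

/-- `L₂(X) = S L₁(R X R*) S*` for some invertible `R`, `S`. -/
def AreEquivalent {ι κ : Type*} [Fintype ι] [DecidableEq ι] [Fintype κ] [DecidableEq κ]
    (L₁ L₂ : Matrix ι ι ℂ →ₗ[ℂ] Matrix κ κ ℂ) : Prop :=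
  ∃ (R : Matrix ι ι ℂ) (S : Matrix κ κ ℂ), IsUnit R ∧ IsUnit S ∧
    ∀ X, L₂ X = S * L₁ (R * X * Rᴴ) * Sᴴ

/-- `L` is equivalent to some doubly stochastic map. -/
def EquivToDoublyStochastic {ι κ : Type*} [Fintype ι] [DecidableEq ι] [Fintype κ] [DecidableEq κ]
    (L : Matrix ι ι ℂ →ₗ[ℂ] Matrix κ κ ℂ) : Prop :=
  ∃ T : Matrix ι ι ℂ →ₗ[ℂ] Matrix κ κ ℂ, IsDoublyStochastic T ∧ AreEquivalent L T

end

end SinkhornKnoppPPT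

/-! Pairing against `1 ⊗ C i` sees only a partial trace, so with `T = Gt B` and `T' = Gt B'` one
gets `T' X = T (traceFst X) ⊗ 1` (`Gt_extension`), with adjoint `Y ↦ 1 ⊗ T* (traceSnd Y)`
(`traceAdjoint_extension`). Equivalence to a doubly stochastic map amounts to positivity plus a
positive definite solution `(P, Q)` of two scaling equations (`equivToDoublyStochastic_iff`).
Partial traces carry solutions for `T'` to solutions for `T`, and tensoring with the identity
carries them back, up to scalars (`equivToDoublyStochastic_extension_iff`). The PPT claim holds
because `B'` is a reindexing of `1 ⊗ B ⊗ 1`. -/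

namespace SinkhornKnoppPPT

/-! ### Partial traces. -/

section PartialTrace

variable {ι κ : Type*}

/-- The partial trace of a matrix over the first factor of its index type. -/
def traceFst [Fintype κ] (X : Matrix (κ × ι) (κ × ι) ℂ) : Matrix ι ι ℂ :=
  ∑ c, X.submatrix (Prod.mk c) (Prod.mk c)

/-- The partial trace of a matrix over the second factor of its index type. -/
def traceSnd [Fintype ι] (X : Matrix (κ × ι) (κ × ι) ℂ) : Matrix κ κ ℂ :=
  ∑ a, X.submatrix (fun c => (c, a)) (fun c => (c, a))

theorem traceFst_apply [Fintype κ] (X : Matrix (κ × ι) (κ × ι) ℂ) (i j : ι) :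
    traceFst X i j = ∑ c, X (c, i) (c, j) := by
  simp [traceFst, Matrix.sum_apply]

theorem traceSnd_apply [Fintype ι] (X : Matrix (κ × ι) (κ × ι) ℂ) (i j : κ) :
    traceSnd X i j = ∑ a, X (i, a) (j, a) := by
  simp [traceSnd, Matrix.sum_apply]

theorem traceFst_posSemidef [Fintype κ] {X : Matrix (κ × ι) (κ × ι) ℂ} (hX : X.PosSemidef) :
    (traceFst X).PosSemidef :=
  Matrix.posSemidef_sum _ fun _ _ => hX.submatrix _

theorem traceFst_posDef [Fintype κ] [Nonempty κ] {X : Matrix (κ × ι) (κ × ι) ℂ} (hX : X.PosDef) :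
    (traceFst X).PosDef :=
  Matrix.posDef_sum Finset.univ_nonempty fun _ _ => hX.submatrix (Prod.mk_right_injective _)

theorem traceSnd_posDef [Fintype ι] [Nonempty ι] {X : Matrix (κ × ι) (κ × ι) ℂ} (hX : X.PosDef) :
    (traceSnd X).PosDef :=
  Matrix.posDef_sum Finset.univ_nonempty fun _ _ => hX.submatrix (Prod.mk_left_injective _)

theorem traceFst_kronecker [Fintype κ] (A : Matrix κ κ ℂ) (B : Matrix ι ι ℂ) :
    traceFst (A ⊗ₖ B) = A.trace • B := by
  ext i j
  simp [traceFst_apply, Matrix.trace, Finset.sum_mul]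

theorem traceSnd_kronecker [Fintype ι] (A : Matrix κ κ ℂ) (B : Matrix ι ι ℂ) :
    traceSnd (A ⊗ₖ B) = B.trace • A := by
  ext i j
  simp [traceSnd_apply, Matrix.trace, Finset.sum_mul, mul_comm (A i j)]

theorem traceFst_one_kronecker_mul [Fintype κ] [Fintype ι] [DecidableEq κ] (A : Matrix ι ι ℂ)
    (X : Matrix (κ × ι) (κ × ι) ℂ) :
    traceFst (((1 : Matrix κ κ ℂ) ⊗ₖ A) * X) = A * traceFst X := by
  ext i j
  simp only [traceFst_apply, Matrix.mul_apply, Fintype.sum_prod_type, Matrix.kroneckerMap_apply,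
    Matrix.one_apply, ite_mul, one_mul, zero_mul, Finset.mul_sum]
  conv_rhs => rw [Finset.sum_comm]
  refine Finset.sum_congr rfl fun c _ => ?_
  rw [Finset.sum_comm]
  simp

theorem traceSnd_kronecker_one_mul [Fintype κ] [Fintype ι] [DecidableEq ι] (A : Matrix κ κ ℂ)
    (X : Matrix (κ × ι) (κ × ι) ℂ) :
    traceSnd ((A ⊗ₖ (1 : Matrix ι ι ℂ)) * X) = A * traceSnd X := by
  ext i j
  simp only [traceSnd_apply, Matrix.mul_apply, Fintype.sum_prod_type, Matrix.kroneckerMap_apply,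
    Matrix.one_apply, mul_ite, ite_mul, mul_one, zero_mul, mul_zero, Finset.mul_sum]
  rw [Finset.sum_comm]
  simp

theorem trace_one_kronecker_mul [Fintype κ] [Fintype ι] [DecidableEq κ] (A : Matrix ι ι ℂ)
    (X : Matrix (κ × ι) (κ × ι) ℂ) :
    (((1 : Matrix κ κ ℂ) ⊗ₖ A) * X).trace = (A * traceFst X).trace := by
  rw [← traceFst_one_kronecker_mul]
  simp only [Matrix.trace, Matrix.diag_apply, traceFst_apply, Fintype.sum_prod_type]
  exact Finset.sum_comm

theorem trace_kronecker_one_mul [Fintype κ] [Fintype ι] [DecidableEq ι] (A : Matrix κ κ ℂ)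
    (X : Matrix (κ × ι) (κ × ι) ℂ) :
    ((A ⊗ₖ (1 : Matrix ι ι ℂ)) * X).trace = (A * traceSnd X).trace := by
  rw [← traceSnd_kronecker_one_mul]
  simp only [Matrix.trace, Matrix.diag_apply, traceSnd_apply, Fintype.sum_prod_type]

theorem traceSnd_conjTranspose [Fintype ι] (X : Matrix (κ × ι) (κ × ι) ℂ) :
    traceSnd Xᴴ = (traceSnd X)ᴴ := by
  ext i j; simp [traceSnd_apply]

end PartialTrace

/-! ### Doubly stochastic scaling as a pair of matrix equations. -/

section Scaling

variable {ι κ : Type*} [Fintype ι] [DecidableEq ι] [Fintype κ]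

theorem traceAdjoint_apply_eq (T : Matrix ι ι ℂ →ₗ[ℂ] Matrix κ κ ℂ) (Y : Matrix κ κ ℂ)
    (Z : Matrix ι ι ℂ) (h : ∀ X, (T X * Yᴴ).trace = (X * Zᴴ).trace) : traceAdjoint T Y = Z := by
  apply Matrix.conjTranspose_injective
  rw [Matrix.ext_iff_trace_mul_left]
  intro X
  rw [← h, trace_traceAdjoint]

theorem traceAdjoint_of_equiv {L₁ L₂ : Matrix ι ι ℂ →ₗ[ℂ] Matrix κ κ ℂ} {R : Matrix ι ι ℂ}
    {S : Matrix κ κ ℂ} (h : ∀ X, L₂ X = S * L₁ (R * X * Rᴴ) * Sᴴ) (Y : Matrix κ κ ℂ) :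
    traceAdjoint L₂ Y = Rᴴ * traceAdjoint L₁ (Sᴴ * Y * S) * R := by
  refine traceAdjoint_apply_eq _ _ _ fun X => ?_
  have h1 := trace_traceAdjoint L₁ (R * X * Rᴴ) (Sᴴ * Y * S)
  rw [h]
  simp only [Matrix.conjTranspose_mul, Matrix.conjTranspose_conjTranspose, mul_assoc] at h1 ⊢
  rw [Matrix.trace_mul_comm S]
  simp only [mul_assoc]
  rw [h1, Matrix.trace_mul_comm R]
  simp only [mul_assoc]

/-- The linear map `X ↦ S L(R X R*) S*`. -/
def conjMap (L : Matrix ι ι ℂ →ₗ[ℂ] Matrix κ κ ℂ) (R : Matrix ι ι ℂ) (S : Matrix κ κ ℂ) :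
    Matrix ι ι ℂ →ₗ[ℂ] Matrix κ κ ℂ where
  toFun X := S * L (R * X * Rᴴ) * Sᴴ
  map_add' X Y := by simp [mul_add, add_mul]
  map_smul' c X := by simp

variable [DecidableEq κ]

theorem isPositiveMap_of_equiv {L₁ L₂ : Matrix ι ι ℂ →ₗ[ℂ] Matrix κ κ ℂ}
    (h : AreEquivalent L₁ L₂) (h₂ : IsPositiveMap L₂) : IsPositiveMap L₁ := by
  obtain ⟨R, S, hR, hS, h⟩ := h
  intro X hX
  obtain ⟨R', hR'⟩ := hR.exists_right_inv
  have h1 := h₂ _ (hX.mul_mul_conjTranspose_same R')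
  have h3 : R * (R' * X * R'ᴴ) * Rᴴ = X := by
    calc R * (R' * X * R'ᴴ) * Rᴴ = (R * R') * X * (R * R')ᴴ := by
          simp only [Matrix.conjTranspose_mul, mul_assoc]
      _ = X := by simp [hR']
  rw [h, h3] at h1
  exact (Matrix.IsUnit.posSemidef_star_right_conjugate_iff hS).1 h1

theorem exists_isUnit_conjTranspose_mul_self {P : Matrix ι ι ℂ} (hP : P.PosDef) :
    ∃ S : Matrix ι ι ℂ, IsUnit S ∧ P = Sᴴ * S := by
  open scoped MatrixOrder in
  obtain ⟨S, hS⟩ := CStarAlgebra.nonneg_iff_eq_star_mul_self.mp hP.posSemidef.nonneg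
  refine ⟨S, ?_, hS⟩
  have h := hP.isUnit
  rw [hS] at h
  rw [Matrix.isUnit_iff_isUnit_det] at h ⊢
  rw [Matrix.det_mul] at h
  exact isUnit_of_mul_isUnit_right h

theorem isDoublyStochastic_iff [Nonempty ι] [Nonempty κ]
    (T : Matrix ι ι ℂ →ₗ[ℂ] Matrix κ κ ℂ) {c : ℂ}
    (hc : c = (√(Fintype.card ι : ℝ) : ℝ) / (√(Fintype.card κ : ℝ) : ℝ)) :
    IsDoublyStochastic T ↔
      IsPositiveMap T ∧ T 1 = c • 1 ∧ traceAdjoint T 1 = c⁻¹ • 1 := by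
  have ha : ((√(Fintype.card ι : ℝ) : ℝ) : ℂ) ≠ 0 := by
    simp
  have hb : ((√(Fintype.card κ : ℝ) : ℝ) : ℂ) ≠ 0 := by
    simp
  rw [IsDoublyStochastic, map_smul, map_smul, inv_smul_eq_iff₀ ha, inv_smul_eq_iff₀ hb, smul_smul,
    smul_smul, hc, inv_div, div_eq_mul_inv, div_eq_mul_inv]

/-- A map is equivalent to a doubly stochastic one iff it is positive and the scaling equations
`L(P) = Q⁻¹`, `L*(Q) = (κ/ι) P⁻¹` have a positive definite solution. -/
theorem equivToDoublyStochastic_iff [Nonempty ι] [Nonempty κ]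
    (L : Matrix ι ι ℂ →ₗ[ℂ] Matrix κ κ ℂ) :
    EquivToDoublyStochastic L ↔ IsPositiveMap L ∧
      ∃ (P : Matrix ι ι ℂ) (Q : Matrix κ κ ℂ), P.PosDef ∧ Q.PosDef ∧ L P * Q = 1 ∧
        (Fintype.card ι : ℂ) • (traceAdjoint L Q * P) = (Fintype.card κ : ℂ) • 1 := by
  obtain ⟨r, hr⟩ : ∃ r : ℝ, r = √(Fintype.card ι : ℝ) / √(Fintype.card κ : ℝ) := ⟨_, rfl⟩
  have hr0 : 0 < r := by rw [hr]; positivity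
  have hrc : (r : ℂ) = (√(Fintype.card ι : ℝ) : ℝ) / (√(Fintype.card κ : ℝ) : ℝ) := by
    rw [hr]; push_cast; rfl
  have hc0 : (r : ℂ) ≠ 0 := by exact_mod_cast hr0.ne'
  have hι : (Fintype.card ι : ℂ) ≠ 0 := by simp
  have hκ : (Fintype.card κ : ℂ) ≠ 0 := by simp
  -- The factor `κ/ι = r⁻²` is forced: `tr (L P * Q) = κ` must equal `tr (L* Q * P)`.
  have hsq : (Fintype.card ι : ℂ) = r ^ 2 * Fintype.card κ := by
    have : (Fintype.card ι : ℝ) = r ^ 2 * Fintype.card κ := by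
      rw [hr, div_pow, Real.sq_sqrt (by positivity), Real.sq_sqrt (by positivity)]
      field_simp
    exact_mod_cast this
  constructor
  · rintro ⟨T, hT, hLT⟩
    rw [isDoublyStochastic_iff T hrc] at hT
    obtain ⟨hpos, hT1, hT2⟩ := hT
    refine ⟨isPositiveMap_of_equiv hLT hpos, ?_⟩
    obtain ⟨R, S, hR, hS, h⟩ := hLT
    rw [traceAdjoint_of_equiv h, mul_one] at hT2
    rw [h, mul_one] at hT1
    -- `S L(R Rᴴ) Sᴴ = r • 1` says that `r⁻¹ Sᴴ S` inverts `L(R Rᴴ)`.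
    refine ⟨R * Rᴴ, ((r⁻¹ : ℝ) : ℂ) • (Sᴴ * S), ?_, ?_, ?_, ?_⟩
    · exact Matrix.PosDef.mul_conjTranspose_self _ (Matrix.vecMul_injective_of_isUnit hR)
    · exact (Matrix.PosDef.conjTranspose_mul_self _ (Matrix.mulVec_injective_of_isUnit hS)).smul
        (by exact_mod_cast inv_pos.2 hr0)
    · apply hS.mul_left_cancel
      rw [Matrix.mul_smul, Matrix.mul_smul, ← mul_assoc, ← mul_assoc, hT1]
      rw [Complex.ofReal_inv, Matrix.smul_mul, one_mul, mul_one, inv_smul_smul₀ hc0]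
    · rw [map_smul, Matrix.smul_mul, smul_smul]
      apply ((Matrix.isUnit_conjTranspose _).2 hR).mul_left_cancel
      rw [Matrix.mul_smul, ← mul_assoc, ← mul_assoc, hT2, hsq]
      simp only [Matrix.smul_mul, Matrix.mul_smul, one_mul, mul_one, smul_smul]
      congr 1
      push_cast
      field_simp
  · rintro ⟨hpos, P, Q, hP, hQ, hPQ, hQP⟩
    -- Reverse the substitution: factor `P` and `r • Q`, and take `R = R'ᴴ`.
    obtain ⟨R', hR', hPR⟩ := exists_isUnit_conjTranspose_mul_self hP
    obtain ⟨S, hS, hQS⟩ := exists_isUnit_conjTranspose_mul_self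
      (hQ.smul (by exact_mod_cast hr0 : (0 : ℂ) < r))
    refine ⟨conjMap L R'ᴴ S, ?_, R'ᴴ, S, (Matrix.isUnit_conjTranspose _).2 hR', hS, fun _ => rfl⟩
    rw [isDoublyStochastic_iff _ hrc]
    refine ⟨fun X hX => (hpos _ (hX.mul_mul_conjTranspose_same _)).mul_mul_conjTranspose_same _,
      ?_, ?_⟩
    · change S * L (R'ᴴ * 1 * R'ᴴᴴ) * Sᴴ = _
      apply hS.mul_right_cancel
      rw [mul_one, Matrix.conjTranspose_conjTranspose, ← hPR, mul_assoc, ← hQS, mul_assoc,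
        Matrix.mul_smul, hPQ]
      simp
    · rw [traceAdjoint_of_equiv (L₁ := L) (R := R'ᴴ) (S := S) (fun _ => rfl), mul_one, ← hQS,
        Matrix.conjTranspose_conjTranspose]
      apply hR'.mul_right_cancel
      rw [mul_assoc, ← hPR, map_smul, Matrix.mul_smul, Matrix.smul_mul, mul_assoc]
      have h2 : traceAdjoint L Q * P = ((r : ℂ) ^ 2)⁻¹ • 1 := by
        apply smul_right_injective _ hι
        simp only [hQP, smul_smul]
        rw [hsq]
        congr 1
        field_simp
      rw [h2, Matrix.mul_smul, smul_smul, mul_one, Matrix.smul_mul, one_mul]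
      congr 1
      field_simp

end Scaling

/-! ### Passing between `T` and `X ↦ T (traceFst X) ⊗ 1`. -/

section Extension

variable {ι κ : Type*} [Fintype ι] [DecidableEq ι] [Fintype κ] [DecidableEq κ]
  {T : Matrix ι ι ℂ →ₗ[ℂ] Matrix κ κ ℂ}
  {T' : Matrix (κ × ι) (κ × ι) ℂ →ₗ[ℂ] Matrix (κ × ι) (κ × ι) ℂ}

/-- The adjoint of `traceFst` is `Z ↦ 1 ⊗ Z`, and that of `Z ↦ Z ⊗ 1` is `traceSnd`. -/
theorem traceAdjoint_extension (hT : ∀ X, T' X = T (traceFst X) ⊗ₖ (1 : Matrix ι ι ℂ))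
    (Y : Matrix (κ × ι) (κ × ι) ℂ) :
    traceAdjoint T' Y = (1 : Matrix κ κ ℂ) ⊗ₖ traceAdjoint T (traceSnd Y) := by
  refine traceAdjoint_apply_eq _ _ _ fun X => ?_
  rw [hT, trace_kronecker_one_mul, traceSnd_conjTranspose, trace_traceAdjoint,
    Matrix.conjTranspose_kronecker, Matrix.conjTranspose_one, Matrix.trace_mul_comm X,
    trace_one_kronecker_mul, Matrix.trace_mul_comm]

theorem isPositiveMap_extension_iff [Nonempty ι] [Nonempty κ]
    (hT : ∀ X, T' X = T (traceFst X) ⊗ₖ (1 : Matrix ι ι ℂ)) :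
    IsPositiveMap T' ↔ IsPositiveMap T := by
  constructor
  · intro h X hX
    obtain ⟨i⟩ := ‹Nonempty ι›
    -- Test on `1 ⊗ X`, whose partial trace is `κ • X`; a diagonal block of the image is `κ • T X`.
    have h1 := (h _ ((Matrix.PosSemidef.one (n := κ) (R := ℂ)).kronecker hX)).submatrix
      (fun c => (c, i))
    rw [hT, traceFst_kronecker, Matrix.trace_one, map_smul] at h1
    have h2 : (0 : ℂ) ≤ (Fintype.card κ : ℂ)⁻¹ := by
      rw [← Complex.ofReal_natCast, ← Complex.ofReal_inv]
      exact_mod_cast inv_nonneg.2 (Nat.cast_nonneg (α := ℝ) (Fintype.card κ))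
    convert h1.smul h2 using 1
    ext a b
    simp
  · intro h X hX
    rw [hT]
    exact (h _ (traceFst_posSemidef hX)).kronecker Matrix.PosSemidef.one

theorem equivToDoublyStochastic_extension_iff [Nonempty ι] [Nonempty κ]
    (hT : ∀ X, T' X = T (traceFst X) ⊗ₖ (1 : Matrix ι ι ℂ)) :
    EquivToDoublyStochastic T' ↔ EquivToDoublyStochastic T := by
  have hι : (Fintype.card ι : ℂ) ≠ 0 := by simp
  have hκ : (Fintype.card κ : ℂ) ≠ 0 := by simp
  have inv_card_pos {n : ℕ} (hn : 0 < n) : (0 : ℂ) < (n : ℂ)⁻¹ := by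
    rw [← Complex.ofReal_natCast, ← Complex.ofReal_inv]
    exact_mod_cast inv_pos.2 (Nat.cast_pos (α := ℝ).2 hn)
  rw [equivToDoublyStochastic_iff, equivToDoublyStochastic_iff, isPositiveMap_extension_iff hT]
  refine and_congr_right fun _ => ⟨?_, ?_⟩
  · rintro ⟨P, Q, hP, hQ, hPQ, hQP⟩
    -- Applying `traceSnd` to `T' P * Q = 1` gives `T (traceFst P) * traceSnd Q = ι • 1`, whence the
    -- factor `ι⁻¹`.
    refine ⟨traceFst P, (Fintype.card ι : ℂ)⁻¹ • traceSnd Q, traceFst_posDef hP,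
      (traceSnd_posDef hQ).smul (inv_card_pos Fintype.card_pos), ?_, ?_⟩
    · rw [Matrix.mul_smul, ← traceSnd_kronecker_one_mul, ← hT, hPQ, ← Matrix.one_kronecker_one,
        traceSnd_kronecker, Matrix.trace_one, inv_smul_smul₀ hι]
    · rw [map_smul, Matrix.smul_mul, smul_inv_smul₀ hι, ← traceFst_one_kronecker_mul,
        ← traceAdjoint_extension hT]
      rw [smul_right_injective _ (by simp : (Fintype.card (κ × ι) : ℂ) ≠ 0) hQP,
        ← Matrix.one_kronecker_one, traceFst_kronecker, Matrix.trace_one]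
  · rintro ⟨P, Q, hP, hQ, hPQ, hQP⟩
    -- The factor `κ⁻¹` offsets `traceFst (1 ⊗ P) = κ • P`; in the adjoint equation `traceSnd (Q ⊗
    -- 1) = ι • Q` then supplies `ι/κ`, as needed.
    refine ⟨1 ⊗ₖ P, (Fintype.card κ : ℂ)⁻¹ • (Q ⊗ₖ 1), Matrix.PosDef.one.kronecker hP,
      (hQ.kronecker Matrix.PosDef.one).smul (inv_card_pos Fintype.card_pos), ?_, ?_⟩
    · rw [hT, traceFst_kronecker, Matrix.trace_one, map_smul, Matrix.smul_kronecker,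
        Matrix.smul_mul, Matrix.mul_smul, smul_inv_smul₀ hκ, ← Matrix.mul_kronecker_mul, hPQ,
        mul_one, Matrix.one_kronecker_one]
    · rw [map_smul, traceAdjoint_extension hT, traceSnd_kronecker, Matrix.trace_one, map_smul,
        Matrix.kronecker_smul, Matrix.smul_mul, Matrix.smul_mul, ← Matrix.mul_kronecker_mul,
        ← Matrix.kronecker_smul, hQP, Matrix.kronecker_smul, inv_smul_smul₀ hκ, mul_one,
        Matrix.one_kronecker_one]

/-- Up to reassociating indices, this matrix is `1 ⊗ A ⊗ 1` with `A` the given positive semidefinite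
one. -/
theorem posSemidef_toKron_extension {α : Type*} (s : Finset α) (C : α → Matrix ι ι ℂ)
    (D : α → Matrix κ κ ℂ) (h : (toKron ι κ (∑ i ∈ s, C i ⊗ₜ[ℂ] D i)).PosSemidef) :
    (toKron (κ × ι) (κ × ι) (∑ i ∈ s, ((1 : Matrix κ κ ℂ) ⊗ₖ C i) ⊗ₜ[ℂ]
      (D i ⊗ₖ (1 : Matrix ι ι ℂ)))).PosSemidef := by
  refine Eq.mpr (congrArg Matrix.PosSemidef ?_)
    ((((Matrix.PosSemidef.one (n := κ) (R := ℂ)).kronecker h).kronecker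
      (Matrix.PosSemidef.one (n := ι) (R := ℂ))).submatrix
        (fun x : (κ × ι) × (κ × ι) => ((x.1.1, (x.1.2, x.2.1)), x.2.2)))
  ext x y
  simp [Matrix.sum_apply, Finset.mul_sum, Finset.sum_mul, mul_assoc]

/-- Partial transposition fixes the identity factor and only replaces `D i` by its transpose, so the
previous lemma covers both conditions. -/
theorem isPPT_extension {α : Type*} (s : Finset α) (C : α → Matrix ι ι ℂ)
    (D : α → Matrix κ κ ℂ) (h : IsPPT (∑ i ∈ s, C i ⊗ₜ[ℂ] D i)) :
    IsPPT (∑ i ∈ s, ((1 : Matrix κ κ ℂ) ⊗ₖ C i) ⊗ₜ[ℂ] (D i ⊗ₖ (1 : Matrix ι ι ℂ))) := by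
  refine ⟨posSemidef_toKron_extension s C D h.1, ?_⟩
  have h2 := h.2
  simp only [map_sum, partialTranspose_tmul] at h2 ⊢
  rw [← map_sum] at h2 ⊢
  simpa only [← Matrix.kroneckerMap_transpose, Matrix.transpose_one] using
    posSemidef_toKron_extension s C (fun i => (D i)ᵀ) h2

theorem Gt_extension {α : Type*} (s : Finset α) (C : α → Matrix ι ι ℂ) (D : α → Matrix κ κ ℂ)
    (X : Matrix (κ × ι) (κ × ι) ℂ) :
    Gt (∑ i ∈ s, ((1 : Matrix κ κ ℂ) ⊗ₖ C i) ⊗ₜ[ℂ] (D i ⊗ₖ (1 : Matrix ι ι ℂ))) X =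
      Gt (∑ i ∈ s, C i ⊗ₜ[ℂ] D i) (traceFst X) ⊗ₖ (1 : Matrix ι ι ℂ) := by
  have h : traceFst Xᵀ = (traceFst X)ᵀ := by
    ext i j; simp [traceFst_apply]
  simp only [Gt_apply, G_sum_tmul, trace_one_kronecker_mul, h]
  ext x y
  simp [Matrix.sum_apply, Finset.sum_mul, mul_assoc]

end Extension

end SinkhornKnoppPPT

theorem mainTheorem4 (k m n : ℕ) (hk : 0 < k) (hm : 0 < m)
    (C : Fin n → Matrix (Fin k) (Fin k) ℂ) (D : Fin n → Matrix (Fin m) (Fin m) ℂ)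
    (B : Matrix (Fin k) (Fin k) ℂ ⊗[ℂ] Matrix (Fin m) (Fin m) ℂ)
    (hB : B = ∑ i, C i ⊗ₜ[ℂ] D i)
    (hPPT : SinkhornKnoppPPT.IsPPT B)
    (B' : Matrix (Fin m × Fin k) (Fin m × Fin k) ℂ ⊗[ℂ] Matrix (Fin m × Fin k) (Fin m × Fin k) ℂ)
    (hB' : B' = ∑ i, ((1 : Matrix (Fin m) (Fin m) ℂ) ⊗ₖ C i) ⊗ₜ[ℂ]
      (D i ⊗ₖ (1 : Matrix (Fin k) (Fin k) ℂ))) :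
    SinkhornKnoppPPT.IsPPT B' ∧
    (SinkhornKnoppPPT.EquivToDoublyStochastic (SinkhornKnoppPPT.Gt B) ↔
      SinkhornKnoppPPT.EquivToDoublyStochastic (SinkhornKnoppPPT.Gt B')) := by
  have : Nonempty (Fin k) := ⟨⟨0, hk⟩⟩
  have : Nonempty (Fin m) := ⟨⟨0, hm⟩⟩
  subst hB hB'
  exact ⟨SinkhornKnoppPPT.isPPT_extension _ C D hPPT,
    (SinkhornKnoppPPT.equivToDoublyStochastic_extension_iff
      (SinkhornKnoppPPT.Gt_extension _ C D)).symm⟩
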